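/- **Theorem (Weak maximum principle).** Let $d\ge 1$, let $Q\subset\mathbb R^{d+1}$ be a bounded open set with points $P=(t,x)\in\mathbb R\times\mathbb R^d$, and let $a$ be a function on $Q$ with values in the non-negative definite symmetric $d\times d$ matrices. Let $\partial_0Q$ denote the intersection of the interiors, relative to $\partial Q$, of $\{P\in\partial Q:\lim_{Q\ni P'\to P}a(P')=0\}$ and of the set of those $P\in\partial Q$ at which $Q$ has an inward-pointing unit normal $(n_0,\vec n)$ with $n_0=0$. Put $\underline Q:=Q\cup\partial_0Q$ and extend $a$ by $0$ to $\partial_0 Q$; let $b:\underline Q\to\mathbb R^d$ and $c:\underline Q\to\mathbb R$ be functions and $$Lu:=-u_t-\operatorname{tr}(aD^2u)-\langle b,Du\rangle+cu ,$$ where $D$, $D^2$ are the gradient and Hessian in $x$. Assume that * $\partial_0Q$ is of class $C^{1,\alpha}$ for some $\alpha\in(0,1]$; * $\lambda_*>0$ on $Q$, where $\lambda(P)$ is the least eigenvalue of $a(P)$ and $\lambda_*$ is its lower semicontinuous envelope, the largest lower semicontinuous function on $Q$ with $\lambda_*\le\lambda$ almost everywhere; * $\langle b,\vec n\rangle>0$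 on $\partial_0Q$, $\;c\ge0$ on $Q$ and on $\partial_0Q$; * $b$ and $c$ are locally bounded on $\underline Q$, and $a$, $b$, as functions on $\underline Q$, are continuous at each point of $\partial_0Q$. Let $u\in C^2_s(\underline Q)$, that is: $u,u_t,u_{x_i},u_{x_ix_j}$ exist and are continuous on $Q$; $u$ and $u_{x_i}$ extend continuously to $\underline Q$; and $\operatorname{tr}(aD^2u)$ extends to a continuous function on $\underline Q$ which vanishes on $\partial_0Q$. Let $u^*:\overline Q\to[-\infty,\infty]$ be the upper semicontinuous envelope of $u$, $u^*(P)=\limsup_{Q\ni P'\to P}u(P')$. For $P^0\in\underline Q$ let $S(P^0)$ be the set consisting of $P^0$ and of all $P\in\underline Q$ which can be joined to $P^0$ by a simple continuous curve in $\underline Q$ along which $t$ is non-increasing from $P$ to $P^0$, and let $\partial_0S(P^0):=\partial_0Q\cap\partial S(P^0)$. If $Lu\le0$ on $Q$ and $u^*$ attains a positive maximum over $\overline Q$ at a point of $\overline{S(P^0)}$, then $u^*$ attains that maximum value at a point of $\overline{S(P^0)}\setminus\bigl(S(P^0)\cup\partial_0S(P^0)\bigr)$. -/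

import Mathlib

open Set Filter Topology MeasureTheory
open scoped NNReal ENNReal

noncomputable section

namespace ParabolicMax

/-- Points `P = (t, x)` of `ℝ^{d+1}`: a time coordinate and a spatial coordinate. -/
abbrev SpaceTime (d : ℕ) : Type := ℝ × EuclideanSpace ℝ (Fin d)

variable {d : ℕ}

/-! ### Boundary geometry -/

/-- `ν = (n₀, n⃗)` is the inward-pointing unit normal of `Q` at `P`: to first order at `P` the set
`Q` is the half-space `{⟨P' - P, ν⟩ > 0}`, so that `∂Q` has the tangent plane `ν^⊥` at `P`. -/
def HasInwardNormal (Q : Set (SpaceTime d)) (P ν : SpaceTime d) : Prop :=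
  ν.1 ^ 2 + ‖ν.2‖ ^ 2 = 1 ∧
    ∀ ε : ℝ, 0 < ε → ∀ᶠ P' in 𝓝 P,
      (ε * ‖P' - P‖ < ν.1 * (P'.1 - P.1) + inner ℝ ν.2 (P'.2 - P.2) → P' ∈ Q) ∧
      (ν.1 * (P'.1 - P.1) + inner ℝ ν.2 (P'.2 - P.2) < -(ε * ‖P' - P‖) → P' ∉ Q)

/-- The interior, relative to the topological boundary `∂Q`, of `{P ∈ ∂Q : p P}`. -/
def boundaryInterior (Q : Set (SpaceTime d)) (p : SpaceTime d → Prop) : Set (SpaceTime d) :=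
  {P | P ∈ frontier Q ∧ ∀ᶠ P' in 𝓝[frontier Q] P, p P'}

/-- The degenerate boundary `∂₀Q` defined by the coefficient `a`. -/
def degBoundary (a : SpaceTime d → Matrix (Fin d) (Fin d) ℝ) (Q : Set (SpaceTime d)) :
    Set (SpaceTime d) :=
  boundaryInterior Q (fun P => Tendsto a (𝓝[Q] P) (𝓝 0)) ∩
    boundaryInterior Q (fun P => ∃ ν : SpaceTime d, HasInwardNormal Q P ν ∧ ν.1 = 0)

/-- `Q ∪ ∂₀Q`. -/
def underline (a : SpaceTime d → Matrix (Fin d) (Fin d) ℝ) (Q : Set (SpaceTime d)) :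
    Set (SpaceTime d) :=
  Q ∪ degBoundary a Q

/-- The boundary portion `Γ ⊆ ∂Q` is of class `C^{1,α}`: near each of its points, `Q` is the
positivity set of a function with `α`-Hölder derivative that does not vanish at the point. -/
def IsC1HolderBoundary (α : ℝ≥0) (Q Γ : Set (SpaceTime d)) : Prop :=
  ∀ P ∈ Γ, ∃ U : Set (SpaceTime d), IsOpen U ∧ P ∈ U ∧ ∃ ρ : SpaceTime d → ℝ,
    DifferentiableOn ℝ ρ U ∧ (∃ C : ℝ≥0, HolderOnWith C α (fderiv ℝ ρ) U) ∧
    fderiv ℝ ρ P ≠ 0 ∧ Q ∩ U = {P' | P' ∈ U ∧ 0 < ρ P'}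

/-- `S(P⁰)`: the points `P` of `Q ∪ ∂₀Q` which can be joined to `P⁰` by a simple continuous curve
in `Q ∪ ∂₀Q` along which the time coordinate is non-increasing from `P` to `P⁰`
(the point `P⁰` itself being included). -/
def reachSet (a : SpaceTime d → Matrix (Fin d) (Fin d) ℝ) (Q : Set (SpaceTime d))
    (P₀ : SpaceTime d) : Set (SpaceTime d) :=
  {P | P ∈ underline a Q ∧ (P = P₀ ∨ ∃ γ : ℝ → SpaceTime d,
    ContinuousOn γ (Icc 0 1) ∧ InjOn γ (Icc 0 1) ∧ MapsTo γ (Icc 0 1) (underline a Q) ∧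
    γ 0 = P ∧ γ 1 = P₀ ∧ AntitoneOn (fun s => (γ s).1) (Icc 0 1))}

/-- `∂₀S(P⁰)`: the part of the degenerate boundary `∂₀Q` that lies on the boundary of `S(P⁰)`. -/
def degBoundaryReach (a : SpaceTime d → Matrix (Fin d) (Fin d) ℝ) (Q : Set (SpaceTime d))
    (P₀ : SpaceTime d) : Set (SpaceTime d) :=
  degBoundary a Q ∩ frontier (reachSet a Q P₀)

/-! ### Derivatives and the operator -/

/-- `u_t`. -/
def timeDeriv (u : SpaceTime d → ℝ) (P : SpaceTime d) : ℝ :=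
  deriv (fun s : ℝ => u (s, P.2)) P.1

/-- The spatial gradient `Du`. -/
def spaceGrad (u : SpaceTime d → ℝ) (P : SpaceTime d) : EuclideanSpace ℝ (Fin d) :=
  gradient (fun x => u (P.1, x)) P.2

/-- The spatial Hessian matrix `D²u = (u_{x_i x_j})`. -/
def spaceHess (u : SpaceTime d → ℝ) (P : SpaceTime d) : Matrix (Fin d) (Fin d) ℝ :=
  Matrix.of fun i j => fderiv ℝ (fderiv ℝ (fun x => u (P.1, x))) P.2
    (EuclideanSpace.single i 1) (EuclideanSpace.single j 1)

/-- `tr(a D²u)`. -/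
def traceTerm (a : SpaceTime d → Matrix (Fin d) (Fin d) ℝ) (u : SpaceTime d → ℝ)
    (P : SpaceTime d) : ℝ :=
  (a P * spaceHess u P).trace

/-- `Lu = -u_t - tr(a D²u) - ⟨b, Du⟩ + c u`. -/
def parabolicOp (a : SpaceTime d → Matrix (Fin d) (Fin d) ℝ)
    (b : SpaceTime d → EuclideanSpace ℝ (Fin d)) (c : SpaceTime d → ℝ)
    (u : SpaceTime d → ℝ) (P : SpaceTime d) : ℝ :=
  -timeDeriv u P - traceTerm a u P - inner ℝ (b P) (spaceGrad u P) + c P * u P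

/-! ### Function spaces -/

/-- Parabolic `C²(Q)`: `u, u_t, u_{x_i}, u_{x_i x_j}` exist and are continuous on the open set
`Q`. -/
structure IsParabolicC2 (Q : Set (SpaceTime d)) (u : SpaceTime d → ℝ) : Prop where
  continuousOn : ContinuousOn u Q
  differentiableAt_time : ∀ P ∈ Q, DifferentiableAt ℝ (fun s : ℝ => u (s, P.2)) P.1
  continuousOn_timeDeriv : ContinuousOn (timeDeriv u) Q
  contDiffAt_space : ∀ P ∈ Q, ContDiffAt ℝ 2 (fun x => u (P.1, x)) P.2
  continuousOn_spaceGrad : ContinuousOn (spaceGrad u) Q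
  continuousOn_spaceHess : ContinuousOn (spaceHess u) Q

/-- The function `f` on `Q` extends to a continuous function on `Q'`. -/
def ExtendsContinuously {Y : Type*} [TopologicalSpace Y] (Q Q' : Set (SpaceTime d))
    (f : SpaceTime d → Y) : Prop :=
  ∃ g : SpaceTime d → Y, ContinuousOn g Q' ∧ EqOn g f Q

/-- `u ∈ C²_s(Q ∪ ∂₀Q)`: `u ∈ C²(Q)`, both `u` and `Du` extend continuously to `Q ∪ ∂₀Q`
(parabolic `C¹` up to `∂₀Q`), and `tr(a D²u)` extends continuously to `Q ∪ ∂₀Q` with value `0`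
on `∂₀Q`. Only the values of `u` on `Q` matter. -/
structure IsC2s (a : SpaceTime d → Matrix (Fin d) (Fin d) ℝ) (Q : Set (SpaceTime d))
    (u : SpaceTime d → ℝ) : Prop where
  c2 : IsParabolicC2 Q u
  extends_self : ExtendsContinuously Q (underline a Q) u
  extends_grad : ExtendsContinuously Q (underline a Q) (spaceGrad u)
  extends_trace : ∃ g : SpaceTime d → ℝ, ContinuousOn g (underline a Q) ∧
    EqOn g (traceTerm a u) Q ∧ ∀ P ∈ degBoundary a Q, g P = 0

/-- The upper semicontinuous envelope `u^* : closure Q → [-∞, ∞]` of `u : Q → ℝ`. -/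
def upperEnvelope (Q : Set (SpaceTime d)) (u : SpaceTime d → ℝ) (P : SpaceTime d) : EReal :=
  limsup (fun P' => (u P' : EReal)) (𝓝[Q] P)

/-! ### Conditions on the coefficients -/

/-- The least eigenvalue of the symmetric matrix `a P`. -/
def leastEigenvalue (a : SpaceTime d → Matrix (Fin d) (Fin d) ℝ) (P : SpaceTime d) : ℝ :=
  sInf (spectrum ℝ (a P))

/-- The lower semicontinuous envelope on `Q`: the largest lower semicontinuous function on `Q`
which is at most `f` almost everywhere on `Q`. -/
def lowerEnvelope (Q : Set (SpaceTime d)) (f : SpaceTime d → ℝ≥0∞) (P : SpaceTime d) : ℝ≥0∞ :=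
  ⨆ g ∈ {g : SpaceTime d → ℝ≥0∞ | LowerSemicontinuousOn g Q ∧
    ∀ᵐ P' ∂(volume.restrict Q), g P' ≤ f P'}, g P

/-- Interior local strict parabolicity `λ_* > 0` on `Q`. -/
def InteriorStrictlyParabolic (a : SpaceTime d → Matrix (Fin d) (Fin d) ℝ)
    (Q : Set (SpaceTime d)) : Prop :=
  ∀ P ∈ Q, 0 < lowerEnvelope Q (fun P' => ENNReal.ofReal (leastEigenvalue a P')) P

/-- `f` is locally bounded on `A`. -/
def LocallyBoundedOn {F : Type*} [Norm F] (A : Set (SpaceTime d)) (f : SpaceTime d → F) : Prop :=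
  ∀ P ∈ A, ∃ C : ℝ, ∀ᶠ P' in 𝓝[A] P, ‖f P'‖ ≤ C

/-- As a function on `Q ∪ ∂₀Q`, `f` is continuous at the points of `∂₀Q`. -/
def ContinuousAlongDegBoundary {Y : Type*} [TopologicalSpace Y]
    (a : SpaceTime d → Matrix (Fin d) (Fin d) ℝ) (Q : Set (SpaceTime d))
    (f : SpaceTime d → Y) : Prop :=
  ∀ P ∈ degBoundary a Q, ContinuousWithinAt f (underline a Q) P

/-- `b^⊥ = ⟨b, n⃗⟩ > 0` on `∂₀Q`, with `n⃗` the inward-pointing unit normal. -/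
def NormalPartPositive (a : SpaceTime d → Matrix (Fin d) (Fin d) ℝ)
    (b : SpaceTime d → EuclideanSpace ℝ (Fin d)) (Q : Set (SpaceTime d)) : Prop :=
  ∀ P ∈ degBoundary a Q, ∀ ν : SpaceTime d, HasInwardNormal Q P ν → 0 < inner ℝ (b P) ν.2

end ParabolicMax

end

namespace ParabolicMax

/-! ### Geometry of the degenerate boundary -/

/-! Suppose the maximum M > 0 is not attained on `closure S` outside `S ∪ ∂₀S`. Then `u^*` < M on
`closure S \ underline a Q`, which is compact because `Q ∪ ∂₀Q` is relatively open in `closure Q`.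
Hence u ≤ m < M on Q near that set. Let v be the continuous extension of u. For small ε, v + εt has
a maximum over the rest of `closure S` at a point P of `Q ∪ ∂₀Q` with v(P) > m ≥ 0.

Points of Q near P that are not earlier lie in `closure S` (`eventually_mem_closure_reachSet`), so P
is a local maximum of v + εt towards later times. This is the useful side: along the curves to P⁰
time does not increase, and Lu ≤ 0 bounds u_t from below.

If P ∈ Q, then Du = 0, tr(aD²u) ≤ 0 and u_t ≤ -ε, so Lu ≥ ε (`not_isMax_of_mem`). If P ∈ ∂₀Q, then
u_t need not extend to P, but Du does and tr(aD²u) tends to 0. Since b points inward, maximality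
gives ⟨b, Du⟩ ≤ 0 at P, whence u_t ≥ -ε/2 in Q near P. A very short step inwards followed by a
longer one forward in time then loses less than εt gains (`not_isMax_of_mem_degBoundary`). -/

theorem degBoundary_subset_frontier {d : ℕ} (a : SpaceTime d → Matrix (Fin d) (Fin d) ℝ)
    (Q : Set (SpaceTime d)) : degBoundary a Q ⊆ frontier Q :=
  fun _ hP => hP.1.1

theorem underline_subset_closure {d : ℕ} (a : SpaceTime d → Matrix (Fin d) (Fin d) ℝ)
    (Q : Set (SpaceTime d)) : underline a Q ⊆ closure Q :=
  union_subset subset_closure ((degBoundary_subset_frontier a Q).trans frontier_subset_closure)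

theorem exists_normal_of_mem_degBoundary {d : ℕ} {a : SpaceTime d → Matrix (Fin d) (Fin d) ℝ}
    {Q : Set (SpaceTime d)} {P : SpaceTime d} (hP : P ∈ degBoundary a Q) :
    ∃ ν : SpaceTime d, HasInwardNormal Q P ν ∧ ν.1 = 0 :=
  hP.2.2.self_of_nhdsWithin hP.2.1

theorem eventually_mem_boundaryInterior {d : ℕ} {Q : Set (SpaceTime d)}
    {p : SpaceTime d → Prop} {P : SpaceTime d} (hP : P ∈ boundaryInterior Q p) :
    ∀ᶠ P' in 𝓝[frontier Q] P, P' ∈ boundaryInterior Q p := by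
  filter_upwards [eventually_eventually_nhdsWithin.2 hP.2, self_mem_nhdsWithin] with P' h1 h2
  exact ⟨h2, h1⟩

/-- `Q ∪ ∂₀Q` is relatively open in the closure of `Q`. -/
theorem eventually_mem_underline {d : ℕ} {a : SpaceTime d → Matrix (Fin d) (Fin d) ℝ}
    {Q : Set (SpaceTime d)} (hQo : IsOpen Q) {P : SpaceTime d} (hP : P ∈ underline a Q) :
    ∀ᶠ P' in 𝓝 P, P' ∈ closure Q → P' ∈ underline a Q := by
  rcases hP with hP | hP
  · filter_upwards [hQo.mem_nhds hP] with P' h _ using Or.inl h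
  · have h : ∀ᶠ P' in 𝓝[frontier Q] P, P' ∈ degBoundary a Q :=
      (eventually_mem_boundaryInterior hP.1).and (eventually_mem_boundaryInterior hP.2)
    filter_upwards [eventually_nhdsWithin_iff.1 h] with P' h1 h2
    by_cases hQ : P' ∈ Q
    · exact Or.inl hQ
    · exact Or.inr (h1 ⟨h2, by rwa [hQo.interior_eq]⟩)

theorem isClosed_diff_underline {d : ℕ} {a : SpaceTime d → Matrix (Fin d) (Fin d) ℝ}
    {Q : Set (SpaceTime d)} (hQo : IsOpen Q) {A : Set (SpaceTime d)} (hA : IsClosed A)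
    (hAQ : A ⊆ closure Q) : IsClosed (A \ underline a Q) := by
  rw [← isOpen_compl_iff, isOpen_iff_mem_nhds]
  intro P hP
  by_cases hPA : P ∈ A
  · have hPu : P ∈ underline a Q := by
      by_contra h
      exact hP ⟨hPA, h⟩
    filter_upwards [eventually_mem_underline hQo hPu] with P' h h'
    exact h'.2 (h (hAQ h'.1))
  · filter_upwards [hA.isOpen_compl.mem_nhds hPA] with P' h h' using h h'.1

/-- Near a point with horizontal inward normal, `Q` contains cones around the normal. -/
theorem HasInwardNormal.exists_cone {d : ℕ} {Q : Set (SpaceTime d)} {P ν : SpaceTime d}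
    (hν : HasInwardNormal Q P ν) (hν0 : ν.1 = 0) {κ : ℝ} (hκ : 0 < κ) :
    ∃ r > 0, ∀ z : SpaceTime d, ‖z‖ < r → κ * ‖z‖ < inner ℝ ν.2 z.2 → P + z ∈ Q := by
  obtain ⟨r, hr, h⟩ := Metric.eventually_nhds_iff.1 (hν.2 κ hκ)
  refine ⟨r, hr, fun z hz hin => (h (y := P + z) (by simpa [dist_eq_norm] using hz)).1 ?_⟩
  simpa [hν0] using hin

theorem HasInwardNormal.norm_snd {d : ℕ} {Q : Set (SpaceTime d)} {P ν : SpaceTime d}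
    (hν : HasInwardNormal Q P ν) (hν0 : ν.1 = 0) : ‖ν.2‖ = 1 := by
  have h := hν.1
  rw [hν0] at h
  nlinarith [norm_nonneg ν.2]

theorem HasInwardNormal.eventually_add_smul_mem {d : ℕ} {Q : Set (SpaceTime d)}
    {P ν : SpaceTime d} (hν : HasInwardNormal Q P ν) (hν0 : ν.1 = 0) {w : SpaceTime d}
    (hw : 0 < inner ℝ ν.2 w.2) : ∀ᶠ s : ℝ in 𝓝[>] 0, P + s • w ∈ Q := by
  -- The +1 makes κ‖w‖ < ⟨ν, w⟩ strict, so the whole ray along w lies in the cone.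
  set κ : ℝ := inner ℝ ν.2 w.2 / (‖w‖ + 1) with hκdef
  have hw1 : 0 < ‖w‖ + 1 := by positivity
  have hκ : 0 < κ := by positivity
  have hκw : κ * ‖w‖ < inner ℝ ν.2 w.2 := by
    rw [hκdef, div_mul_eq_mul_div, div_lt_iff₀ hw1]
    nlinarith
  obtain ⟨r, hr, h⟩ := hν.exists_cone hν0 hκ
  have hlim : Tendsto (fun s : ℝ => ‖s • w‖) (𝓝[>] 0) (𝓝 0) := by
    have : Continuous fun s : ℝ => ‖s • w‖ := by fun_prop
    simpa using (this.tendsto 0).mono_left nhdsWithin_le_nhds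
  filter_upwards [hlim.eventually_lt_const hr, self_mem_nhdsWithin] with s hs1 hs0
  have hs0' : 0 < s := hs0
  refine h _ hs1 ?_
  rw [norm_smul, Real.norm_of_nonneg hs0'.le, Prod.smul_snd, inner_smul_right]
  nlinarith

theorem tendsto_add_smul_nhdsWithin {d : ℕ} {Q : Set (SpaceTime d)} {P w : SpaceTime d}
    (h : ∀ᶠ s : ℝ in 𝓝[>] 0, P + s • w ∈ Q) :
    Tendsto (fun s : ℝ => P + s • w) (𝓝[>] 0) (𝓝[Q] P) := by
  refine tendsto_nhdsWithin_iff.2 ⟨?_, h⟩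
  have : Continuous fun s : ℝ => P + s • w := by fun_prop
  simpa using (this.tendsto 0).mono_left nhdsWithin_le_nhds

/-- A defining function of `Q` increases strictly in the direction of the inward normal. -/
theorem fderiv_normal_pos {d : ℕ} {Q U : Set (SpaceTime d)} {P ν : SpaceTime d}
    {ρ : SpaceTime d → ℝ} (hν : HasInwardNormal Q P ν) (hν0 : ν.1 = 0) (hPQ : P ∉ Q)
    (hU : IsOpen U) (hPU : P ∈ U) (hρ : DifferentiableOn ℝ ρ U) (hρ0 : fderiv ℝ ρ P ≠ 0)
    (hQU : Q ∩ U = {P' | P' ∈ U ∧ 0 < ρ P'}) : 0 < fderiv ℝ ρ P ν := by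
  have hdiff : HasFDerivAt ρ (fderiv ℝ ρ P) P :=
    ((hρ P hPU).differentiableAt (hU.mem_nhds hPU)).hasFDerivAt
  have hρP : ρ P ≤ 0 := by
    by_contra! h
    exact hPQ ((hQU.symm ▸ ⟨hPU, h⟩ : P ∈ Q ∩ U)).1
  -- Since ρ(P) ≤ 0 < ρ(P + sw) for small s > 0, the difference quotients are nonnegative.
  have key : ∀ w : SpaceTime d, 0 < inner ℝ ν.2 w.2 → 0 ≤ fderiv ℝ ρ P w := by
    intro w hw
    have hev := hν.eventually_add_smul_mem hν0 hw
    have hd : HasDerivAt (fun s : ℝ => ρ (P + s • w)) (fderiv ℝ ρ P w) 0 := by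
      have h1 : HasDerivAt (fun s : ℝ => P + s • w) w 0 := by
        simpa using ((hasDerivAt_id (0 : ℝ)).smul_const w).const_add P
      have h2 : HasFDerivAt ρ (fderiv ℝ ρ P) (P + (0 : ℝ) • w) := by simpa using hdiff
      exact h2.comp_hasDerivAt 0 h1
    have hslope := (hasDerivWithinAt_iff_tendsto_slope' (s := Ioi (0 : ℝ)) (by simp)).1
      hd.hasDerivWithinAt
    refine ge_of_tendsto hslope ?_
    have hUev := (tendsto_nhdsWithin_iff.1 (tendsto_add_smul_nhdsWithin hev)).1.eventually
      (hU.mem_nhds hPU)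
    filter_upwards [hev, hUev, self_mem_nhdsWithin] with s h1 h2 h3
    have hs : (0 : ℝ) < s := h3
    have : 0 < ρ (P + s • w) := (hQU ▸ ⟨h1, h2⟩ : P + s • w ∈ {P' | P' ∈ U ∧ 0 < ρ P'}).2
    rw [slope_def_field]
    simp only [zero_smul, add_zero, sub_zero]
    exact div_nonneg (by linarith) hs.le
  have hn := hν.norm_snd hν0
  have hνν : inner ℝ ν.2 ν.2 = (1 : ℝ) := by rw [real_inner_self_eq_norm_sq, hn]; norm_num
  refine lt_of_le_of_ne (key ν (by rw [hνν]; norm_num)) fun h0 => hρ0 ?_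
  -- If the derivative vanished on ν, adding a multiple of ν would move any w into the half-space of
  -- `key`. A linear form that is nonnegative everywhere is zero.
  have key2 : ∀ w : SpaceTime d, 0 ≤ fderiv ℝ ρ P w := by
    intro w
    set k : ℝ := |inner ℝ ν.2 w.2| + 1
    have h := key (k • ν + w) (by
      rw [Prod.snd_add, Prod.smul_snd, inner_add_right, inner_smul_right, hνν]
      have := neg_abs_le (inner ℝ ν.2 w.2 : ℝ)
      simp only [k]; linarith)
    rwa [map_add, map_smul, ← h0, smul_zero, zero_add] at h
  refine ContinuousLinearMap.ext fun w => le_antisymm ?_ (key2 w)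
  have h := key2 (-w)
  rw [map_neg] at h
  exact neg_nonneg.1 h

/-! ### Reachability along segments -/

/-- Frees curves from the parameter interval [0, 1]. A curve of length 0 cannot be rescaled
injectively and falls under the clause P = P⁰. -/
theorem mem_reachSet_of_curve {d : ℕ} {a : SpaceTime d → Matrix (Fin d) (Fin d) ℝ}
    {Q : Set (SpaceTime d)} {P₀ X : SpaceTime d} {l : ℝ} (hl : 0 ≤ l) {η : ℝ → SpaceTime d}
    (hc : ContinuousOn η (Icc 0 l)) (hi : InjOn η (Icc 0 l))
    (hm : MapsTo η (Icc 0 l) (underline a Q)) (h0 : η 0 = X) (h1 : η l = P₀)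
    (ht : AntitoneOn (fun s => (η s).1) (Icc 0 l)) : X ∈ reachSet a Q P₀ := by
  refine ⟨h0 ▸ hm ⟨le_rfl, hl⟩, ?_⟩
  rcases hl.eq_or_lt with rfl | hl'
  · exact Or.inl (h0.symm.trans h1)
  have hmaps : MapsTo (fun s : ℝ => l * s) (Icc 0 1) (Icc 0 l) := fun s hs =>
    ⟨mul_nonneg hl hs.1, by nlinarith [hs.2]⟩
  refine Or.inr ⟨fun s => η (l * s), hc.comp (by fun_prop) hmaps, ?_, hm.comp hmaps, by simpa using h0,
    by simpa using h1, ?_⟩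
  · intro s hs s' hs' h
    exact mul_left_cancel₀ hl'.ne' (hi (hmaps hs) (hmaps hs') h)
  · intro s hs s' hs' h
    exact ht (hmaps hs) (hmaps hs') (mul_le_mul_of_nonneg_left h hl)

/-- A point joined to a reachable point by a segment along which time does not increase is
reachable: follow the segment up to the first point on the given curve. -/
theorem mem_reachSet_of_segment {d : ℕ} {a : SpaceTime d → Matrix (Fin d) (Fin d) ℝ}
    {Q : Set (SpaceTime d)} {P₀ R X : SpaceTime d} (hR : R ∈ reachSet a Q P₀)
    (ht : R.1 ≤ X.1) (hseg : ∀ s ∈ Icc (0 : ℝ) 1, X + s • (R - X) ∈ underline a Q) :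
    X ∈ reachSet a Q P₀ := by
  rcases eq_or_ne X R with rfl | hne
  · exact hR
  set σ : ℝ → SpaceTime d := fun s => X + s • (R - X) with hσ
  have hσc : Continuous σ := by fun_prop
  have hσi : Function.Injective σ := by
    intro s s' h
    exact smul_left_injective ℝ (sub_ne_zero.2 hne.symm) (add_left_cancel h)
  have hσt : Antitone fun s => (σ s).1 := by
    intro s s' h
    simp only [hσ, Prod.fst_add, Prod.smul_fst, Prod.fst_sub, smul_eq_mul]
    nlinarith
  have hσ0 : σ 0 = X := by simp [hσ]
  have hσ1 : σ 1 = R := by simp [hσ]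
  rcases hR.2 with rfl | ⟨γ, hγc, hγi, hγm, hγ0, hγ1, hγt⟩
  · exact mem_reachSet_of_curve zero_le_one hσc.continuousOn hσi.injOn hseg hσ0 hσ1
      (hσt.antitoneOn _)
  have hA : IsCompact (Icc (0 : ℝ) 1 ∩ σ ⁻¹' (γ '' Icc 0 1)) :=
    isCompact_Icc.inter_right ((isCompact_Icc.image_of_continuousOn hγc).isClosed.preimage hσc)
  obtain ⟨s₀, ⟨hs₀, τ₀, hτ₀, hστ⟩, hmin⟩ := hA.exists_isLeast
    ⟨1, right_mem_Icc.2 zero_le_one, 0, left_mem_Icc.2 zero_le_one, hγ0.trans hσ1.symm⟩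
  set η : ℝ → SpaceTime d := fun s => if s ≤ s₀ then σ s else γ (τ₀ + (s - s₀)) with hη
  have hη1 : ∀ s, s ≤ s₀ → η s = σ s := fun s hs => if_pos hs
  have hη2 : ∀ s, s₀ ≤ s → η s = γ (τ₀ + (s - s₀)) := by
    intro s hs
    rcases hs.eq_or_lt with rfl | h
    · rw [hη1 _ le_rfl, sub_self, add_zero, hστ]
    · exact if_neg h.not_ge
  have hI : ∀ s ∈ Icc s₀ (s₀ + (1 - τ₀)), τ₀ + (s - s₀) ∈ Icc (0 : ℝ) 1 := fun s hs =>
    ⟨by linarith [hs.1, hτ₀.1], by linarith [hs.2]⟩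
  have hsplit : Icc (0 : ℝ) (s₀ + (1 - τ₀)) = Icc 0 s₀ ∪ Icc s₀ (s₀ + (1 - τ₀)) :=
    (Icc_union_Icc_eq_Icc hs₀.1 (by linarith [hτ₀.2])).symm
  have hS : ∀ s ∈ Icc (0 : ℝ) s₀, s ∈ Icc (0 : ℝ) 1 := fun s hs => ⟨hs.1, hs.2.trans hs₀.2⟩
  refine mem_reachSet_of_curve (l := s₀ + (1 - τ₀)) (η := η) (by linarith [hs₀.1, hτ₀.2]) ?_ ?_ ?_
    (by rw [hη1 _ hs₀.1, hσ0]) ?_ ?_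
  · rw [hsplit]
    refine ContinuousOn.union_of_isClosed ?_ ?_ isClosed_Icc isClosed_Icc
    · exact hσc.continuousOn.congr fun s hs => hη1 s hs.2
    · exact ContinuousOn.congr (hγc.comp (by fun_prop) hI) fun s hs => hη2 s hs.1
  · have hlt : ∀ s s', 0 ≤ s → s < s₀ → s₀ ≤ s' → s' ≤ s₀ + (1 - τ₀) → η s ≠ η s' := by
      intro s s' h0 h1 h2 h3 h
      rw [hη1 s h1.le, hη2 s' h2] at h
      exact absurd (hmin ⟨hS s ⟨h0, h1.le⟩, _, hI s' ⟨h2, h3⟩, h.symm⟩) h1.not_ge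
    intro s hs s' hs' h
    rcases lt_or_ge s s₀ with h1 | h1 <;> rcases lt_or_ge s' s₀ with h2 | h2
    · rw [hη1 s h1.le, hη1 s' h2.le] at h
      exact hσi h
    · exact absurd h (hlt s s' hs.1 h1 h2 hs'.2)
    · exact absurd h.symm (hlt s' s hs'.1 h2 h1 hs.2)
    · rw [hη2 s h1, hη2 s' h2] at h
      have := hγi (hI s ⟨h1, hs.2⟩) (hI s' ⟨h2, hs'.2⟩) h
      linarith
  · rw [hsplit]
    rintro s (hs | hs)
    · rw [hη1 s hs.2]
      exact hseg s (hS s hs)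
    · rw [hη2 s hs.1]
      exact hγm (hI s hs)
  · rw [hη2 _ (by linarith [hτ₀.2]), ← hγ1]
    congr 1
    ring
  · have hle : ∀ s s', s ≤ s' → s' ≤ s₀ → (η s').1 ≤ (η s).1 := by
      intro s s' h h1
      rw [hη1 s (h.trans h1), hη1 s' h1]
      exact hσt h
    have hge : ∀ s s', s₀ ≤ s → s ≤ s' → s' ≤ s₀ + (1 - τ₀) → (η s').1 ≤ (η s).1 := by
      intro s s' h0 h h1
      rw [hη2 s h0, hη2 s' (h0.trans h)]
      exact hγt (hI s ⟨h0, h.trans h1⟩) (hI s' ⟨h0.trans h, h1⟩) (by linarith)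
    intro s hs s' hs' h
    change (η s').1 ≤ (η s).1
    rcases le_total s' s₀ with h2 | h2
    · exact hle s s' h h2
    rcases le_total s s₀ with h1 | h1
    · exact (hge s₀ s' le_rfl h2 hs'.2).trans (hle s s₀ h1 le_rfl)
    · exact hge s s' h1 h hs'.2

/-- Near a point of `∂₀Q` every point of `Q` can be joined to every earlier point of `Q ∪ ∂₀Q`. -/
theorem exists_nhds_mem_reachSet_of_degBoundary {d : ℕ}
    {a : SpaceTime d → Matrix (Fin d) (Fin d) ℝ} {Q : Set (SpaceTime d)} {α : ℝ≥0} (hα : 0 < α)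
    (hQo : IsOpen Q) (hreg : IsC1HolderBoundary α Q (degBoundary a Q)) {P : SpaceTime d}
    (hP : P ∈ degBoundary a Q) (P₀ : SpaceTime d) :
    ∃ W ∈ 𝓝 P, ∀ X ∈ W, X ∈ Q → ∀ R ∈ W, R ∈ reachSet a Q P₀ → R.1 ≤ X.1 →
      X ∈ reachSet a Q P₀ := by
  obtain ⟨ν, hν, hν0⟩ := exists_normal_of_mem_degBoundary hP
  obtain ⟨U, hU, hPU, ρ, hρ, ⟨C, hC⟩, hρ0, hQU⟩ := hreg P hP
  have hPQ : P ∉ Q := by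
    have := (degBoundary_subset_frontier a Q hP).2
    rwa [hQo.interior_eq] at this
  have hpos := fderiv_normal_pos hν hν0 hPQ hU hPU hρ hρ0 hQU
  have hcont : ContinuousAt (fun Y => fderiv ℝ ρ Y ν) P :=
    ((hC.continuousOn hα).continuousAt (hU.mem_nhds hPU)).clm_apply continuousAt_const
  obtain ⟨r₁, hr₁, hB⟩ := Metric.eventually_nhds_iff.1
    ((hcont.eventually_const_lt hpos).and (hU.mem_nhds hPU))
  obtain ⟨r₂, hr₂, hcone⟩ := hν.exists_cone hν0 (κ := 1 / 4) (by norm_num)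
  have hn := hν.norm_snd hν0
  have hνn : ‖ν‖ = 1 := by rw [Prod.norm_def, hν0, hn]; simp
  -- For X within δ/4 of P and 0 ≤ s ≤ δ, the point X + sν is within 5δ/4 of P, inside both balls.
  set δ : ℝ := min r₁ r₂ / 2 with hδ
  have hm : 0 < min r₁ r₂ := lt_min hr₁ hr₂
  have hδ0 : 0 < δ := by positivity
  have hδ1 : 2 * δ ≤ r₁ := by rw [hδ]; linarith [min_le_left r₁ r₂]
  have hδ2 : 2 * δ ≤ r₂ := by rw [hδ]; linarith [min_le_right r₁ r₂]
  have hball : ∀ X ∈ Metric.ball P (δ / 4), ∀ s ∈ Icc (0 : ℝ) δ,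
      0 < fderiv ℝ ρ (X + s • ν) ν ∧ X + s • ν ∈ U := by
    intro X hX s hs
    refine hB ?_
    rw [Metric.mem_ball, dist_eq_norm] at hX
    rw [dist_eq_norm, add_sub_right_comm]
    have h1 := norm_add_le (X - P) (s • ν)
    rw [norm_smul, hνn, Real.norm_of_nonneg hs.1] at h1
    linarith [hs.2]
  have hup : ∀ X ∈ Metric.ball P (δ / 4), X ∈ closure Q → ∀ s ∈ Ioc (0 : ℝ) δ, X + s • ν ∈ Q := by
    intro X hX hXQ s hs
    have hder : ∀ s ∈ Icc (0 : ℝ) δ,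
        HasDerivAt (fun s : ℝ => ρ (X + s • ν)) (fderiv ℝ ρ (X + s • ν) ν) s := by
      intro s hs
      have hXU := (hball X hX s hs).2
      have h1 : HasDerivAt (fun s : ℝ => X + s • ν) ν s := by
        simpa using ((hasDerivAt_id s).smul_const ν).const_add X
      exact ((hρ _ hXU).differentiableAt (hU.mem_nhds hXU)).hasFDerivAt.comp_hasDerivAt s h1
    have hmono : StrictMonoOn (fun s : ℝ => ρ (X + s • ν)) (Icc 0 δ) := by
      refine strictMonoOn_of_deriv_pos (convex_Icc 0 δ)
        (fun s hs => (hder s hs).continuousAt.continuousWithinAt) fun s hs => ?_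
      have hs' := interior_subset hs
      rw [(hder s hs').deriv]
      exact (hball X hX s hs').1
    have h0 : 0 ≤ ρ X := by
      have hXU : X ∈ U := by simpa using (hball X hX 0 ⟨le_rfl, hδ0.le⟩).2
      have hXc : ContinuousAt ρ X := (hρ.continuousOn).continuousAt (hU.mem_nhds hXU)
      by_contra! hlt
      obtain ⟨Y, ⟨hY1, hY2⟩, hY3⟩ := mem_closure_iff_nhds.1 hXQ _
        (inter_mem (hXc.eventually_lt_const hlt) (hU.mem_nhds hXU))
      have : 0 < ρ Y := (hQU ▸ ⟨hY3, hY2⟩ : Y ∈ {P' | P' ∈ U ∧ 0 < ρ P'}).2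
      exact absurd hY1 this.not_gt
    have h1 := hmono (left_mem_Icc.2 hδ0.le) (Ioc_subset_Icc_self hs) hs.1
    simp only [zero_smul, add_zero] at h1
    exact (hQU.symm ▸ ⟨(hball X hX s (Ioc_subset_Icc_self hs)).2, h0.trans_lt h1⟩ :
      X + s • ν ∈ Q ∩ U).1
  -- The displacement from P has norm below 5δ/4 and normal component above 3δ/4, so it lies in the
  -- cone with κ = 1/4.
  have htop : ∀ X ∈ Metric.ball P (δ / 4), X + δ • ν ∈ Q := by
    intro X hX
    rw [Metric.mem_ball, dist_eq_norm] at hX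
    have h1 := norm_add_le (X - P) (δ • ν)
    rw [norm_smul, hνn, Real.norm_of_nonneg hδ0.le] at h1
    have h2 : P + ((X - P) + δ • ν) = X + δ • ν := by abel
    rw [← h2]
    refine hcone _ (by linarith) ?_
    have hνν : inner ℝ ν.2 ν.2 = (1 : ℝ) := by rw [real_inner_self_eq_norm_sq, hn]; norm_num
    have h3 := (abs_le.1 (abs_real_inner_le_norm ν.2 (X - P).2)).1
    have h4 : ‖(X - P).2‖ ≤ ‖X - P‖ := norm_snd_le _
    rw [hn] at h3
    rw [Prod.snd_add, Prod.smul_snd, inner_add_right, inner_smul_right, hνν]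
    linarith
  refine ⟨Metric.ball P (δ / 4), Metric.ball_mem_nhds _ (by positivity), ?_⟩
  intro X hX hXQ R hR hRS hRX
  have hRc : R ∈ closure Q := underline_subset_closure a Q hRS.1
  -- The route is X, X + δν, R + δν, R, built from its end. As ν is horizontal, only the middle
  -- segment changes time.
  have step1 : R + δ • ν ∈ reachSet a Q P₀ := by
    refine mem_reachSet_of_segment hRS (by simp [hν0]) fun s hs => ?_
    have : R + δ • ν + s • (R - (R + δ • ν)) = R + ((1 - s) * δ) • ν := by module
    rw [this]
    rcases hs.2.eq_or_lt with rfl | h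
    · simpa using hRS.1
    · refine Or.inl (hup R hR hRc _ ⟨mul_pos (by linarith) hδ0, ?_⟩)
      nlinarith [hs.1]
  have step2 : X + δ • ν ∈ reachSet a Q P₀ := by
    refine mem_reachSet_of_segment step1 (by simpa [hν0] using hRX) fun s hs => ?_
    have : X + δ • ν + s • (R + δ • ν - (X + δ • ν)) = (X + s • (R - X)) + δ • ν := by module
    rw [this]
    exact Or.inl (htop _ ((convex_ball P (δ / 4)).add_smul_sub_mem hX hR hs))
  refine mem_reachSet_of_segment step2 (by simp [hν0]) fun s hs => ?_
  have : X + s • (X + δ • ν - X) = X + (s * δ) • ν := by module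
  rw [this]
  rcases hs.1.eq_or_lt with rfl | h
  · rw [zero_mul, zero_smul, add_zero]
    exact Or.inl hXQ
  · refine Or.inl (hup X hX (subset_closure hXQ) _ ⟨mul_pos h hδ0, ?_⟩)
    nlinarith [hs.2]

/-- Near a point of the closure of `S(P⁰)` in `Q ∪ ∂₀Q`, all points of `Q` that are not earlier
belong to the closure of `S(P⁰)`. -/
theorem eventually_mem_closure_reachSet {d : ℕ}
    {a : SpaceTime d → Matrix (Fin d) (Fin d) ℝ} {Q : Set (SpaceTime d)} {α : ℝ≥0} (hα : 0 < α)
    (hQo : IsOpen Q) (hreg : IsC1HolderBoundary α Q (degBoundary a Q)) {P P₀ : SpaceTime d}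
    (hP : P ∈ underline a Q) (hPS : P ∈ closure (reachSet a Q P₀)) :
    ∀ᶠ P' in 𝓝[Q] P, P.1 ≤ P'.1 → P' ∈ closure (reachSet a Q P₀) := by
  obtain ⟨W, hW, hWS⟩ : ∃ W ∈ 𝓝 P, ∀ X ∈ W, X ∈ Q → ∀ R ∈ W, R ∈ reachSet a Q P₀ → R.1 ≤ X.1 →
      X ∈ reachSet a Q P₀ := by
    rcases hP with hP | hP
    · obtain ⟨r, hr, hrQ⟩ := Metric.isOpen_iff.1 hQo P hP
      refine ⟨Metric.ball P r, Metric.ball_mem_nhds P hr, fun X hX _ R hR hRS hRX => ?_⟩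
      exact mem_reachSet_of_segment hRS hRX fun s hs =>
        Or.inl (hrQ ((convex_ball P r).add_smul_sub_mem hX hR hs))
    · exact exists_nhds_mem_reachSet_of_degBoundary hα hQo hreg hP P₀
  obtain ⟨V, hVW, hV, hPV⟩ := mem_nhds_iff.1 hW
  -- A strictly later X is later than some point of S close to P. Points at the same time as P are
  -- only limits of such X, hence the closure in the conclusion.
  have hlate : ∀ X ∈ V, X ∈ Q → P.1 < X.1 → X ∈ reachSet a Q P₀ := by
    intro X hX hXQ hlt
    obtain ⟨R, ⟨hR1, hR2⟩, hR3⟩ := mem_closure_iff_nhds.1 hPS _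
      (inter_mem hW (continuousAt_fst.eventually_lt_const hlt))
    exact hWS X (hVW hX) hXQ R hR1 hR3 (le_of_lt hR2)
  filter_upwards [mem_nhdsWithin_of_mem_nhds (hV.mem_nhds hPV), self_mem_nhdsWithin]
    with X hX hXQ hle
  have hcont : Continuous fun s : ℝ => ((X.1 + s, X.2) : SpaceTime d) := by fun_prop
  have hlim : Tendsto (fun s : ℝ => ((X.1 + s, X.2) : SpaceTime d)) (𝓝[>] 0) (𝓝 X) := by
    simpa using (hcont.tendsto 0).mono_left nhdsWithin_le_nhds
  refine mem_closure_of_tendsto hlim ?_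
  filter_upwards [hlim.eventually (hV.mem_nhds hX), hlim.eventually (hQo.mem_nhds hXQ),
    self_mem_nhdsWithin] with s h1 h2 h3
  have hs : (0 : ℝ) < s := h3
  exact hlate _ h1 h2 (by simpa using by linarith)

/-! ### Second-order conditions at a maximum -/

theorem fderiv_fderiv_nonpos_of_isLocalMax {E : Type*} [NormedAddCommGroup E] [NormedSpace ℝ E]
    {f : E → ℝ} {x : E} (hf : ContDiffAt ℝ 2 f x) (hmax : IsLocalMax f x) (w : E) :
    fderiv ℝ (fderiv ℝ f) x w w ≤ 0 := by
  set φ : ℝ → ℝ := fun s => f (x + s • w) with hφ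
  have hline : ∀ s : ℝ, HasDerivAt (fun s : ℝ => x + s • w) w s := fun s => by
    simpa using ((hasDerivAt_id s).smul_const w).const_add x
  have hlim : Tendsto (fun s : ℝ => x + s • w) (𝓝 0) (𝓝 x) := by
    have : Continuous fun s : ℝ => x + s • w := by fun_prop
    simpa using this.tendsto 0
  have hdiff : ∀ᶠ y in 𝓝 x, DifferentiableAt ℝ f y :=
    (hf.eventually (by simp)).mono fun y hy => hy.differentiableAt (by simp)
  have h1 : deriv φ =ᶠ[𝓝 0] fun s => fderiv ℝ f (x + s • w) w := by
    filter_upwards [hlim.eventually hdiff] with s hs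
    exact (hs.hasFDerivAt.comp_hasDerivAt s (hline s)).deriv
  have h2 : deriv (deriv φ) 0 = fderiv ℝ (fderiv ℝ f) x w w := by
    rw [h1.deriv_eq]
    have hd : HasFDerivAt (fderiv ℝ f) (fderiv ℝ (fderiv ℝ f) x) (x + (0 : ℝ) • w) := by
      rw [zero_smul, add_zero]
      exact ((hf.fderiv_right (m := 1) (by norm_num)).differentiableAt (by simp)).hasFDerivAt
    have h : HasDerivAt (fun s : ℝ => fderiv ℝ f (x + s • w)) (fderiv ℝ (fderiv ℝ f) x w) 0 :=
      hd.comp_hasDerivAt 0 (hline 0)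
    exact (((ContinuousLinearMap.apply ℝ ℝ w).hasFDerivAt).comp_hasDerivAt 0 h).deriv
  have hφmax : IsLocalMax φ 0 := by
    have := hlim.eventually hmax
    simpa [IsLocalMax, IsMaxFilter, hφ] using this
  have hφc : ContinuousAt φ 0 := by
    have : ContinuousAt f (x + (0 : ℝ) • w) := by simpa using hf.continuousAt
    exact ContinuousAt.comp (f := fun s : ℝ => x + s • w) this (hline 0).continuousAt
  -- A positive second derivative would make 0 a minimum as well, so φ would be locally constant.
  by_contra! hpos
  have hφmin : IsLocalMin φ 0 :=
    isLocalMin_of_deriv_deriv_pos (h2 ▸ hpos) hφmax.deriv_eq_zero hφc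
  have hconst : φ =ᶠ[𝓝 0] fun _ => φ 0 := by
    filter_upwards [hφmax, hφmin] with s hs hs' using le_antisymm hs hs'
  have h3 : deriv (deriv φ) 0 = 0 := by
    rw [hconst.deriv.deriv_eq]
    simp
  linarith

theorem exists_eq_conjTranspose_mul_self {ι : Type*} [Fintype ι] {A : Matrix ι ι ℝ}
    (hA : A.PosSemidef) : ∃ B : Matrix ι ι ℝ, A = B.conjTranspose * B := by
  classical
  open scoped MatrixOrder in
  obtain ⟨X, hX, -, h⟩ := CFC.exists_sqrt_of_isSelfAdjoint_of_quasispectrumRestricts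
    hA.isHermitian (QuasispectrumRestricts.nnreal_of_nonneg hA.nonneg)
  refine ⟨X, ?_⟩
  rw [← Matrix.star_eq_conjTranspose, hX.star_eq]
  exact h.symm

/-- Writing A = BᵀB turns the trace into tr(BHBᵀ), the sum of the values of the quadratic form H at
the rows of B. -/
theorem trace_mul_nonpos_of_posSemidef {ι : Type*} [Fintype ι] {A H : Matrix ι ι ℝ}
    (hA : A.PosSemidef) (hH : ∀ w : ι → ℝ, w ⬝ᵥ H.mulVec w ≤ 0) : (A * H).trace ≤ 0 := by
  classical
  obtain ⟨B, rfl⟩ := exists_eq_conjTranspose_mul_self hA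
  rw [Matrix.mul_assoc, Matrix.trace_mul_comm, Matrix.trace]
  refine Finset.sum_nonpos fun k _ => ?_
  have : (B * H * B.conjTranspose).diag k = B k ⬝ᵥ H.mulVec (B k) := by
    rw [Matrix.mul_assoc, Matrix.diag_apply, Matrix.mul_apply]
    rfl
  rw [this]
  exact hH _

theorem dotProduct_spaceHess {d : ℕ} (u : SpaceTime d → ℝ) (P : SpaceTime d) (w : Fin d → ℝ) :
    w ⬝ᵥ (spaceHess u P).mulVec w = fderiv ℝ (fderiv ℝ (fun x => u (P.1, x))) P.2
      (WithLp.toLp 2 w) (WithLp.toLp 2 w) := by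
  have hw : (WithLp.toLp 2 w : EuclideanSpace ℝ (Fin d)) =
      ∑ i, w i • EuclideanSpace.single i (1 : ℝ) := by
    ext j
    simp [Finset.sum_apply, Pi.single_apply]
  rw [hw]
  simp only [map_sum, map_smul, _root_.sum_apply, _root_.smul_apply,
    smul_eq_mul, dotProduct, Matrix.mulVec, spaceHess, Matrix.of_apply, Finset.mul_sum]
  rw [Finset.sum_comm]
  refine Finset.sum_congr rfl fun i _ => Finset.sum_congr rfl fun j _ => ?_
  ring

/-! ### Exclusion of one-sided maxima -/

/-- The function `u`, lifted by `ε t`, has no one-sided local maximum at interior points. -/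
theorem not_isMax_of_mem {d : ℕ} {a : SpaceTime d → Matrix (Fin d) (Fin d) ℝ}
    {b : SpaceTime d → EuclideanSpace ℝ (Fin d)} {c u : SpaceTime d → ℝ} {Q : Set (SpaceTime d)}
    {P : SpaceTime d} (hPQ : P ∈ Q) (ha : (a P).PosSemidef) (hc : 0 ≤ c P)
    (hu : IsParabolicC2 Q u) (hLu : parabolicOp a b c u P ≤ 0) (hpos : 0 < u P) {ε : ℝ}
    (hε : 0 < ε) (hmax : ∀ᶠ P' in 𝓝 P, P.1 ≤ P'.1 → u P' + ε * P'.1 ≤ u P + ε * P.1) : False := by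
  -- The one-sided condition includes equal times, so in space the maximum is two-sided.
  have hxmax : IsLocalMax (fun x => u (P.1, x)) P.2 := by
    have hl : Tendsto (fun x => ((P.1, x) : SpaceTime d)) (𝓝 P.2) (𝓝 P) :=
      (Continuous.prodMk_right P.1).tendsto P.2
    filter_upwards [hl.eventually hmax] with x hx
    simpa using hx
  have hgrad : spaceGrad u P = 0 := by
    simp [spaceGrad, gradient, hxmax.fderiv_eq_zero]
  have htr : traceTerm a u P ≤ 0 := by
    refine trace_mul_nonpos_of_posSemidef ha fun w => ?_
    rw [dotProduct_spaceHess]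
    exact fderiv_fderiv_nonpos_of_isLocalMax (hu.contDiffAt_space P hPQ) hxmax _
  have ht : timeDeriv u P ≤ -ε := by
    have hd := (hu.differentiableAt_time P hPQ).hasDerivAt
    have hslope := (hasDerivWithinAt_iff_tendsto_slope' (s := Ioi P.1) (by simp)).1
      hd.hasDerivWithinAt
    refine le_of_tendsto hslope ?_
    have hl : Tendsto (fun s => ((s, P.2) : SpaceTime d)) (𝓝 P.1) (𝓝 P) :=
      (Continuous.prodMk_left P.2).tendsto P.1
    filter_upwards [(hl.eventually hmax).filter_mono nhdsWithin_le_nhds, self_mem_nhdsWithin]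
      with s hs hs1
    have hlt : P.1 < s := hs1
    rw [slope_def_field, div_le_iff₀ (by linarith)]
    have := hs hlt.le
    linarith
  rw [parabolicOp, hgrad, inner_zero_right] at hLu
  nlinarith [mul_nonneg hc hpos.le]

/-- Stated for v because the mean value theorem is applied on segments starting on ∂₀Q, where only
the extension v is continuous. -/
theorem hasDerivAt_spatial_line {d : ℕ} {u v : SpaceTime d → ℝ} {Q : Set (SpaceTime d)}
    (hQo : IsOpen Q) (hu : IsParabolicC2 Q u) (hv : EqOn v u Q) {P : SpaceTime d}
    {w : EuclideanSpace ℝ (Fin d)} {s : ℝ} (hs : P + s • ((0, w) : SpaceTime d) ∈ Q) :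
    HasDerivAt (fun s : ℝ => v (P + s • ((0, w) : SpaceTime d)))
      (inner ℝ (spaceGrad u (P + s • ((0, w) : SpaceTime d))) w) s := by
  have hline : HasDerivAt (fun s : ℝ => P.2 + s • w) w s := by
    simpa using ((hasDerivAt_id s).smul_const w).const_add P.2
  have heq : ∀ s : ℝ, P + s • ((0, w) : SpaceTime d) = (P.1, P.2 + s • w) := fun s => by
    ext <;> simp
  have hd : HasGradientAt (fun x => u (P.1, x)) (spaceGrad u (P.1, P.2 + s • w)) (P.2 + s • w) :=
    ((hu.contDiffAt_space _ (heq s ▸ hs)).differentiableAt (by simp)).hasGradientAt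
  have h : HasDerivAt (fun s : ℝ => u (P.1, P.2 + s • w))
      (inner ℝ (spaceGrad u (P.1, P.2 + s • w)) w) s := by
    have h1 := hd.hasFDerivAt.comp_hasDerivAt s hline
    rwa [InnerProductSpace.toDual_apply_apply] at h1
  rw [heq]
  refine h.congr_of_eventuallyEq ?_
  have hc : Continuous fun s : ℝ => P + s • ((0, w) : SpaceTime d) := by fun_prop
  filter_upwards [hc.continuousAt.eventually (hQo.mem_nhds hs)] with s' hs'
  rw [hv hs', heq]

/-- The function `u`, lifted by `ε t`, has no one-sided local maximum at points of `∂₀Q`. -/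
theorem not_isMax_of_mem_degBoundary {d : ℕ} {a : SpaceTime d → Matrix (Fin d) (Fin d) ℝ}
    {b : SpaceTime d → EuclideanSpace ℝ (Fin d)} {c u v : SpaceTime d → ℝ} {Q : Set (SpaceTime d)}
    (hQo : IsOpen Q) {P : SpaceTime d} (hP : P ∈ degBoundary a Q) (hc : ∀ P' ∈ Q, 0 ≤ c P')
    (hbperp : NormalPartPositive a b Q) (hbcont : ContinuousAlongDegBoundary a Q b)
    (hu : IsC2s a Q u) (hLu : ∀ P' ∈ Q, parabolicOp a b c u P' ≤ 0)
    (hvc : ContinuousOn v (underline a Q)) (hvu : EqOn v u Q) (hpos : 0 < v P) {ε : ℝ}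
    (hε : 0 < ε)
    (hmax : ∀ᶠ P' in 𝓝[Q] P, P.1 ≤ P'.1 → v P' + ε * P'.1 ≤ v P + ε * P.1) : False := by
  obtain ⟨ν, hν, hν0⟩ := exists_normal_of_mem_degBoundary hP
  have hn := hν.norm_snd hν0
  have hνν : inner ℝ ν.2 ν.2 = (1 : ℝ) := by rw [real_inner_self_eq_norm_sq, hn]; norm_num
  obtain ⟨G, hGc, hGu⟩ := hu.extends_grad
  obtain ⟨g, hgc, hgu, hg0⟩ := hu.extends_trace
  have hPu : P ∈ underline a Q := Or.inr hP
  have hsub : Q ⊆ underline a Q := subset_union_left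
  have hgrad : Tendsto (spaceGrad u) (𝓝[Q] P) (𝓝 (G P)) :=
    (((hGc P hPu).mono hsub).tendsto).congr' (eventually_mem_nhdsWithin.mono fun _ h => hGu h)
  have htrace : Tendsto (traceTerm a u) (𝓝[Q] P) (𝓝 0) := by
    rw [← hg0 P hP]
    exact (((hgc P hPu).mono hsub).tendsto).congr' (eventually_mem_nhdsWithin.mono fun _ h => hgu h)
  have hval : Tendsto u (𝓝[Q] P) (𝓝 (v P)) :=
    (((hvc P hPu).mono hsub).tendsto).congr' (eventually_mem_nhdsWithin.mono fun _ h => hvu h)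
  have hb : Tendsto b (𝓝[Q] P) (𝓝 (b P)) := (hbcont P hP).mono hsub
  -- the drift points inward, so the gradient term has a sign at the maximum
  have hsign : inner ℝ (b P) (G P) ≤ 0 := by
    by_contra! hlt
    have hbν : 0 < inner ℝ ν.2 (((0, b P) : SpaceTime d)).2 := by
      rw [real_inner_comm]; exact hbperp P hP ν hν
    have hline := hν.eventually_add_smul_mem hν0 hbν
    have hlim := tendsto_add_smul_nhdsWithin hline
    have hinner : Tendsto (fun P' => inner ℝ (spaceGrad u P') (b P)) (𝓝[Q] P)
        (𝓝 (inner ℝ (G P) (b P))) := hgrad.inner tendsto_const_nhds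
    rw [real_inner_comm] at hlt
    obtain ⟨s₁, hs₁, hsub₁⟩ := mem_nhdsGT_iff_exists_Ioo_subset.1
      ((hline.and (hlim.eventually (hinner.eventually_const_lt hlt))).and (hlim.eventually hmax))
    have hs₁' : (0 : ℝ) < s₁ := hs₁
    have hmem : ∀ s ∈ Ioo 0 s₁, _ := fun s hs => hsub₁ hs
    -- If ⟨b, Du⟩ > 0 at P, v would increase strictly along b(P), at constant time, against
    -- maximality.
    obtain ⟨ξ, hξ, hslope⟩ := exists_hasDerivAt_eq_slope
      (fun s : ℝ => v (P + s • ((0, b P) : SpaceTime d)))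
      (fun s : ℝ => inner ℝ (spaceGrad u (P + s • ((0, b P) : SpaceTime d))) (b P))
      (half_pos hs₁') (by
        refine hvc.comp (by fun_prop) fun s hs => ?_
        rcases hs.1.eq_or_lt with rfl | h
        · simpa using hPu
        · exact hsub (hmem s ⟨h, by linarith [hs.2]⟩).1.1)
      (fun s hs => hasDerivAt_spatial_line hQo hu.c2 hvu (hmem s ⟨hs.1, by linarith [hs.2]⟩).1.1)
    have h1 := (hmem ξ ⟨hξ.1, by linarith [hξ.2]⟩).1.2
    have h2 := (hmem (s₁ / 2) ⟨half_pos hs₁', by linarith⟩).2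
    have h3 : (P + (s₁ / 2) • ((0, b P) : SpaceTime d)).1 = P.1 := by simp
    have h4 := h2 h3.ge
    simp only [zero_smul, add_zero, sub_zero] at hslope
    rw [hslope, lt_div_iff₀ (half_pos hs₁'), zero_mul] at h1
    rw [h3] at h4
    linarith
  set C : ℝ := ‖G P‖ + 1
  have hC : 0 < C := by positivity
  have hfacts : ∀ᶠ P' in 𝓝[Q] P, (-(ε / 2) ≤ timeDeriv u P' ∧ ‖spaceGrad u P'‖ < C) ∧
      (P.1 ≤ P'.1 → v P' + ε * P'.1 ≤ v P + ε * P.1) := by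
    have hbg : Tendsto (fun P' => inner ℝ (b P') (spaceGrad u P')) (𝓝[Q] P)
        (𝓝 (inner ℝ (b P) (G P))) := hb.inner hgrad
    filter_upwards [hbg.eventually_lt_const (show inner ℝ (b P) (G P) < ε / 4 by linarith),
      htrace.eventually_lt_const (show 0 < ε / 4 by linarith), hval.eventually_const_lt hpos,
      hgrad.norm.eventually_lt_const (show ‖G P‖ < C by simp [C]), hmax, self_mem_nhdsWithin]
      with P' h1 h2 h3 h4 h5 h6
    have h7 := hLu P' h6
    have h8 := mul_nonneg (hc P' h6) h3.le
    rw [parabolicOp] at h7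
    exact ⟨⟨by linarith, h4⟩, h5⟩
  obtain ⟨r₁, hr₁, hB⟩ := Metric.eventually_nhds_iff.1 (eventually_nhdsWithin_iff.1 hfacts)
  -- η is the ratio of the inward step to the time step. The inward loss is at most Cηh < εh/2,
  -- where C bounds |Du| near P.
  set η : ℝ := ε / (4 * C + ε) with hη
  have hη0 : 0 < η := by positivity
  have hη1 : η < 1 := by rw [hη, div_lt_one (by positivity)]; linarith
  have hηC : C * η < ε / 2 := by
    rw [hη, mul_div_assoc', div_lt_iff₀ (by positivity)]
    nlinarith [mul_pos hC hε]
  -- The final displacement (h, ηhν) has sup norm h and normal component ηh > (η/2)h.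
  obtain ⟨r₂, hr₂, hcone⟩ := hν.exists_cone hν0 (half_pos hη0)
  set h : ℝ := min r₁ r₂ / 2 with hh
  have hm : 0 < min r₁ r₂ := lt_min hr₁ hr₂
  have hh0 : 0 < h := by positivity
  have hh1 : h < r₁ := by rw [hh]; linarith [min_le_left r₁ r₂]
  have hh2 : h < r₂ := by rw [hh]; linarith [min_le_right r₁ r₂]
  -- the points reached by a short inward move followed by a vertical one
  have hmem : ∀ τ ∈ Icc (0 : ℝ) h, ∀ σ ∈ Ioc (0 : ℝ) (η * h), (τ = 0 ∨ σ = η * h) →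
      P + ((τ, σ • ν.2) : SpaceTime d) ∈ Q ∧
      ((-(ε / 2) ≤ timeDeriv u (P + ((τ, σ • ν.2) : SpaceTime d)) ∧
        ‖spaceGrad u (P + ((τ, σ • ν.2) : SpaceTime d))‖ < C) ∧
      (P.1 ≤ P.1 + τ → v (P + ((τ, σ • ν.2) : SpaceTime d)) + ε * (P.1 + τ) ≤
        v P + ε * P.1)) := by
    intro τ hτ σ hσ hor
    have hσh : σ ≤ h := hσ.2.trans (by nlinarith)
    have hnorm : ‖((τ, σ • ν.2) : SpaceTime d)‖ = max τ σ := by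
      rw [Prod.norm_mk, norm_smul, hn, mul_one, Real.norm_of_nonneg hτ.1,
        Real.norm_of_nonneg hσ.1.le]
    have hle : max τ σ ≤ h := max_le hτ.2 hσh
    have hQ : P + ((τ, σ • ν.2) : SpaceTime d) ∈ Q := by
      refine hcone _ (by rw [hnorm]; linarith) ?_
      rw [hnorm, inner_smul_right, hνν, mul_one]
      rcases hor with rfl | rfl
      · rw [max_eq_right hσ.1.le]
        nlinarith [hσ.1]
      · nlinarith
    have := hB (y := P + ((τ, σ • ν.2) : SpaceTime d))
      (by rw [dist_eq_norm, add_sub_cancel_left, hnorm]; linarith) hQ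
    exact ⟨hQ, this⟩
  have hηh : 0 < η * h := mul_pos hη0 hh0
  have hmove : ∀ σ : ℝ, σ • ((0, ν.2) : SpaceTime d) = (0, σ • ν.2) := fun σ => by simp
  obtain ⟨ξ, hξ, hslope⟩ := exists_hasDerivAt_eq_slope
    (fun s : ℝ => v (P + s • ((0, ν.2) : SpaceTime d)))
    (fun s : ℝ => inner ℝ (spaceGrad u (P + s • ((0, ν.2) : SpaceTime d))) ν.2) hηh (by
      refine hvc.comp (by fun_prop) fun s hs => ?_
      rcases hs.1.eq_or_lt with rfl | h1
      · simpa using hPu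
      · rw [hmove]
        exact hsub (hmem 0 ⟨le_rfl, hh0.le⟩ s ⟨h1, hs.2⟩ (Or.inl rfl)).1)
    (fun s hs => hasDerivAt_spatial_line hQo hu.c2 hvu (by
      rw [hmove]
      exact (hmem 0 ⟨le_rfl, hh0.le⟩ s ⟨hs.1, hs.2.le⟩ (Or.inl rfl)).1))
  have hspace : -(C * (η * h)) ≤ v (P + ((0, (η * h) • ν.2) : SpaceTime d)) - v P := by
    have h1 := (hmem 0 ⟨le_rfl, hh0.le⟩ ξ ⟨hξ.1, hξ.2.le⟩ (Or.inl rfl)).2.1.2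
    have h2 := (abs_le.1 (abs_real_inner_le_norm
      (spaceGrad u (P + ((0, ξ • ν.2) : SpaceTime d))) ν.2)).1
    simp only [hmove, zero_smul, Prod.mk_zero_zero, add_zero, sub_zero] at hslope
    rw [hslope, hn, mul_one] at h2
    have h3 := (le_div_iff₀ hηh).1 (show -C ≤ _ by linarith)
    linarith
  set X : SpaceTime d := P + ((0, (η * h) • ν.2) : SpaceTime d)
  have hX : ∀ τ : ℝ, ((X.1 + τ, X.2) : SpaceTime d) = P + ((τ, (η * h) • ν.2) : SpaceTime d) :=
    fun τ => by ext <;> simp [X]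
  have hder : ∀ τ ∈ Icc (0 : ℝ) h, HasDerivAt (fun τ : ℝ => u (X.1 + τ, X.2))
      (timeDeriv u (X.1 + τ, X.2)) τ := by
    intro τ hτ
    have hQ := (hmem τ hτ (η * h) ⟨hηh, le_rfl⟩ (Or.inr rfl)).1
    rw [← hX] at hQ
    have hd := (hu.c2.differentiableAt_time _ hQ).hasDerivAt
    exact hd.comp_const_add X.1 τ
  obtain ⟨τ, hτ, hslope'⟩ := exists_hasDerivAt_eq_slope _ _ hh0
    (fun τ hτ => (hder τ hτ).continuousAt.continuousWithinAt)
    (fun τ hτ => hder τ (Ioo_subset_Icc_self hτ))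
  have h1 := (hmem τ (Ioo_subset_Icc_self hτ) (η * h) ⟨hηh, le_rfl⟩ (Or.inr rfl)).2.1.1
  rw [← hX, hslope', le_div_iff₀ (by linarith), hX, hX] at h1
  obtain ⟨hQh, -, h2⟩ := hmem h ⟨hh0.le, le_rfl⟩ (η * h) ⟨hηh, le_rfl⟩ (Or.inr rfl)
  have hQ0 := (hmem 0 ⟨le_rfl, hh0.le⟩ (η * h) ⟨hηh, le_rfl⟩ (Or.inr rfl)).1
  have h3 := h2 (by linarith)
  rw [← hvu hQh, ← hvu hQ0] at h1
  -- Together the two moves lose at most Cηh + εh/2 < εh, whereas maximality demands a loss of at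
  -- least εh.
  nlinarith [mul_lt_mul_of_pos_right hηC hh0]

/-! ### The upper envelope -/

theorem upperEnvelope_eq {d : ℕ} {a : SpaceTime d → Matrix (Fin d) (Fin d) ℝ}
    {Q : Set (SpaceTime d)} {u v : SpaceTime d → ℝ} (hvc : ContinuousOn v (underline a Q))
    (hvu : EqOn v u Q) {P : SpaceTime d} (hP : P ∈ underline a Q) :
    upperEnvelope Q u P = (v P : EReal) := by
  have : (𝓝[Q] P).NeBot := mem_closure_iff_nhdsWithin_neBot.1 (underline_subset_closure a Q hP)
  refine Tendsto.limsup_eq ?_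
  refine (continuous_coe_real_ereal.tendsto _).comp ?_
  exact (((hvc P hP).mono subset_union_left).tendsto).congr'
    (eventually_mem_nhdsWithin.mono fun _ h => hvu h)

/-- If the upper envelope is below a real number `M > 0` on a compact set, then `u ≤ m` near that
set for some `m < M`. -/
theorem exists_open_le_of_upperEnvelope_lt {d : ℕ} {Q K : Set (SpaceTime d)}
    {u : SpaceTime d → ℝ} (hK : IsCompact K) {M : ℝ} (hM : 0 < M)
    (hlt : ∀ P ∈ K, upperEnvelope Q u P < (M : EReal)) :
    ∃ m, 0 ≤ m ∧ m < M ∧ ∃ V, IsOpen V ∧ K ⊆ V ∧ ∀ P ∈ V, P ∈ Q → u P ≤ m := by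
  refine hK.induction_on
    (p := fun K => ∃ m, 0 ≤ m ∧ m < M ∧ ∃ V, IsOpen V ∧ K ⊆ V ∧ ∀ P ∈ V, P ∈ Q → u P ≤ m)
    ?_ ?_ ?_ ?_
  · exact ⟨0, le_rfl, hM, ∅, isOpen_empty, subset_rfl, fun _ h => h.elim⟩
  · rintro A B hAB ⟨m, h0, h1, V, hV, hBV, h⟩
    exact ⟨m, h0, h1, V, hV, hAB.trans hBV, h⟩
  · rintro A B ⟨m, h0, h1, V, hV, hAV, h⟩ ⟨m', h0', h1', V', hV', hBV, h'⟩
    refine ⟨max m m', h0.trans (le_max_left _ _), max_lt h1 h1', V ∪ V', hV.union hV',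
      union_subset_union hAV hBV, ?_⟩
    rintro P (hP | hP) hPQ
    · exact (h P hP hPQ).trans (le_max_left _ _)
    · exact (h' P hP hPQ).trans (le_max_right _ _)
  · intro P hP
    obtain ⟨m, hm1, hm2⟩ := EReal.lt_iff_exists_real_btwn.1 (hlt P hP)
    have hm2' : m < M := EReal.coe_lt_coe_iff.1 hm2
    have hev : ∀ᶠ P' in 𝓝[Q] P, (u P' : EReal) < (m : EReal) := eventually_lt_of_limsup_lt hm1
    obtain ⟨V, hVsub, hV, hPV⟩ := mem_nhds_iff.1 (eventually_nhdsWithin_iff.1 hev)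
    -- Keeping the bound nonnegative ensures that values above it are positive, as the sign of cu
    -- requires.
    refine ⟨V, mem_nhdsWithin_of_mem_nhds (hV.mem_nhds hPV), max m 0, le_max_right _ _,
      max_lt hm2' hM, V, hV, subset_rfl, fun P' h1 h2 => ?_⟩
    exact (EReal.coe_lt_coe_iff.1 (hVsub h1 h2)).le.trans (le_max_left _ _)

end ParabolicMax

/-! ### The weak maximum principle -/

theorem mainTheorem6 (d : ℕ) (hd : 1 ≤ d)
    (Q : Set (ParabolicMax.SpaceTime d)) (hQo : IsOpen Q) (hQb : Bornology.IsBounded Q)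
    (a : ParabolicMax.SpaceTime d → Matrix (Fin d) (Fin d) ℝ)
    (b : ParabolicMax.SpaceTime d → EuclideanSpace ℝ (Fin d))
    (c : ParabolicMax.SpaceTime d → ℝ)
    (ha : ∀ P ∈ Q, (a P).PosSemidef)
    (α : ℝ≥0) (hα : 0 < α) (hα1 : α ≤ 1)
    (hreg : ParabolicMax.IsC1HolderBoundary α Q (ParabolicMax.degBoundary a Q))
    (hpar : ParabolicMax.InteriorStrictlyParabolic a Q)
    (hbperp : ParabolicMax.NormalPartPositive a b Q)
    (hc : ∀ P ∈ Q, 0 ≤ c P)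
    (hc0 : ∀ P ∈ ParabolicMax.degBoundary a Q, 0 ≤ c P)
    (hbloc : ParabolicMax.LocallyBoundedOn (ParabolicMax.underline a Q) b)
    (hcloc : ParabolicMax.LocallyBoundedOn (ParabolicMax.underline a Q) c)
    (hacont : ParabolicMax.ContinuousAlongDegBoundary a Q a)
    (hbcont : ParabolicMax.ContinuousAlongDegBoundary a Q b)
    (u : ParabolicMax.SpaceTime d → ℝ) (hu : ParabolicMax.IsC2s a Q u)
    (hLu : ∀ P ∈ Q, ParabolicMax.parabolicOp a b c u P ≤ 0)
    (P₀ : ParabolicMax.SpaceTime d) (hP₀ : P₀ ∈ ParabolicMax.underline a Q)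
    (P₁ : ParabolicMax.SpaceTime d)
    (hP₁ : P₁ ∈ closure (ParabolicMax.reachSet a Q P₀))
    (hpos : 0 < ParabolicMax.upperEnvelope Q u P₁)
    (hmax : ∀ P ∈ closure Q, ParabolicMax.upperEnvelope Q u P ≤ ParabolicMax.upperEnvelope Q u P₁) :
    ∃ P₂ ∈ closure (ParabolicMax.reachSet a Q P₀),
      P₂ ∉ ParabolicMax.reachSet a Q P₀ ∪ ParabolicMax.degBoundaryReach a Q P₀ ∧
      ParabolicMax.upperEnvelope Q u P₂ = ParabolicMax.upperEnvelope Q u P₁ := by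
  set S := ParabolicMax.reachSet a Q P₀ with hS
  have hSQ : closure S ⊆ closure Q := closure_minimal
    (fun P hP => ParabolicMax.underline_subset_closure a Q hP.1) isClosed_closure
  by_contra hcon
  push Not at hcon
  have hout : ∀ P ∈ closure S \ ParabolicMax.underline a Q,
      ParabolicMax.upperEnvelope Q u P < ParabolicMax.upperEnvelope Q u P₁ := by
    rintro P ⟨hPS, hPu⟩
    refine lt_of_le_of_ne (hmax P (hSQ hPS)) (hcon P hPS ?_)
    rintro (h | h)
    · exact hPu h.1
    · exact hPu (Or.inr h.1)
  obtain ⟨v, hvc, hvu⟩ := hu.extends_self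
  have hP₁u : P₁ ∈ ParabolicMax.underline a Q := by
    by_contra h
    exact lt_irrefl _ (hout P₁ ⟨hP₁, h⟩)
  have hM : ParabolicMax.upperEnvelope Q u P₁ = (v P₁ : EReal) :=
    ParabolicMax.upperEnvelope_eq hvc hvu hP₁u
  rw [hM] at hout hpos
  have hM0 : 0 < v P₁ := by exact_mod_cast hpos
  have hcl : IsCompact (closure S) := hQb.isCompact_closure.of_isClosed_subset isClosed_closure hSQ
  have hK : IsCompact (closure S \ ParabolicMax.underline a Q) := hcl.of_isClosed_subset
    (ParabolicMax.isClosed_diff_underline hQo isClosed_closure hSQ) sdiff_subset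
  obtain ⟨m, hm0, hmM, V, hV, hKV, hVm⟩ :=
    ParabolicMax.exists_open_le_of_upperEnvelope_lt hK hM0 hout
  have hT : IsCompact (closure S \ V) := hcl.diff hV
  have hTu : closure S \ V ⊆ ParabolicMax.underline a Q := by
    rintro P ⟨hPS, hPV⟩
    by_contra h
    exact hPV (hKV ⟨hPS, h⟩)
  -- points of `Q ∪ ∂₀Q` with value above `m` are not in `V`
  have hnV : ∀ P ∈ ParabolicMax.underline a Q, m < v P → P ∉ V := by
    intro P hPu hlt hPV
    obtain ⟨O, hO, hPO, hOm⟩ := mem_nhdsWithin.1 ((hvc P hPu).eventually_const_lt hlt)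
    obtain ⟨P', ⟨h1, h2⟩, h3⟩ := mem_closure_iff.1 (ParabolicMax.underline_subset_closure a Q hPu)
      (O ∩ V) (hO.inter hV) ⟨hPO, hPV⟩
    have h4 : m < v P' := hOm ⟨h1, Or.inl h3⟩
    rw [hvu h3] at h4
    exact absurd (hVm P' h2 h3) h4.not_ge
  obtain ⟨D, hD⟩ := (hcl.image continuous_fst).isBounded.exists_norm_le
  have hDt : ∀ P ∈ closure S, |P.1| ≤ D := fun P hP => hD _ (mem_image_of_mem _ hP)
  have hD0 : 0 ≤ D := (abs_nonneg _).trans (hDt P₁ hP₁)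
  -- On `closure S` the term εt varies by at most 2Dε < M - m, so the maximiser of v + εt still has
  -- v > m.
  set ε : ℝ := (v P₁ - m) / (2 * D + 1) with hε
  have hε0 : 0 < ε := div_pos (sub_pos.2 hmM) (by positivity)
  have hεD : ε * (2 * D) < v P₁ - m := by
    have : ε * (2 * D + 1) = v P₁ - m := div_mul_cancel₀ _ (by positivity)
    linarith
  obtain ⟨P, hPT, hPmax⟩ := hT.exists_isMaxOn ⟨P₁, hP₁, hnV P₁ hP₁u hmM⟩
    (f := fun P => v P + ε * P.1) ((hvc.mono hTu).add (by fun_prop))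
  have hPu := hTu hPT
  have hmP : m < v P := by
    have h1 : v P₁ + ε * P₁.1 ≤ v P + ε * P.1 := hPmax ⟨hP₁, hnV P₁ hP₁u hmM⟩
    have h2 := (abs_le.1 (hDt P hPT.1)).2
    have h3 := (abs_le.1 (hDt P₁ hP₁)).1
    nlinarith
  -- Near P continuity keeps v above m, so these points avoid V and compete in the maximum.
  have hloc : ∀ᶠ P' in 𝓝[Q] P, P.1 ≤ P'.1 → v P' + ε * P'.1 ≤ v P + ε * P.1 := by
    filter_upwards [ParabolicMax.eventually_mem_closure_reachSet hα hQo hreg hPu hPT.1,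
      ((hvc P hPu).mono subset_union_left).eventually_const_lt hmP, self_mem_nhdsWithin]
      with P' h1 h2 h3 h4
    exact hPmax ⟨h1 h4, hnV P' (Or.inl h3) h2⟩
  rcases hPu with hPQ | hPd
  · refine ParabolicMax.not_isMax_of_mem hPQ (ha P hPQ) (hc P hPQ) hu.c2 (hLu P hPQ)
      (by rw [← hvu hPQ]; linarith) hε0 ?_
    rw [hQo.nhdsWithin_eq hPQ] at hloc
    filter_upwards [hloc, hQo.mem_nhds hPQ] with P' h1 h2
    rwa [← hvu hPQ, ← hvu h2]
  · exact ParabolicMax.not_isMax_of_mem_degBoundary hQo hPd hc hbperp hbcont hu hLu hvc hvu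
      (hm0.trans_lt hmP) hε0 hloc
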